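/- Let $k=\tfrac34$, $\alpha>0$ and $0<\beta<1$ be fixed. For $p\in(0,1)$ and an integer $w\ge 0$, let $x_i=\bigl\lfloor (w^{1-k}+\alpha(1-k)i)^{1/(1-k)}\bigr\rfloor$, $i=0,1,2,\dots$, be the number of packets sent in the $i$-th round trip when the initial window is $w$; every packet is lost, independently of the others, with probability $p$, and $G^p_w$ denotes the index of the first round trip in which a packet is lost, so that $\mathbb P(G^p_w>m)=(1-p)^{x_0+\cdots+x_m}$. Let $(V_n(p))_{n\ge0}$ be the Markov chain $$V_{n+1}(p)=(1-\beta)\bigl(V_n(p)^{1-k}+\alpha(1-k)\,G_n\bigr)^{\frac1{1-k}},$$ where, given $V_0(p),\dots,V_n(p)$, the variable $G_n$ has the law of $G^p_{w}$ with $w=\lfloor V_n(p)\rfloor$. For $x\ge0$ let $\overline G_x\ge 0$ be a random variable with, for $y\ge0$, $$\mathbb P(\overline G_x\ge y)=\exp\Bigl(-xy-2\alpha(1-k)x^ky^2-2\alpha^2(1-k)^2x^{2k-1}y^3-\alpha^3(1-k)^3x^{3k-2}y^4-\tfrac{\alpha^4(1-k)^4x^{4k-3}y^5}{5}\Bigr)$$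 (here $x^{4k-3}=x^0=1$, also for $x=0$), and let $(\overline V_n)_{n\ge0}$ be the Markov chain $$\overline V_{n+1}=(1-\beta)\bigl(\overline V_n^{\,1-k}+\alpha(1-k)\,\overline G_n\bigr)^{\frac1{1-k}},$$ where, given $\overline V_0,\dots,\overline V_n$, the variable $\overline G_n$ has the law of $\overline G_{x}$ with $x=\overline V_n$. Let $\mathbb P_x$ denote the law of the two chains when $\overline V_0=x$ and $V_0(p)=\lfloor x/p^{1/(2-k)}\rfloor$. Then for every $n$ and all $a_1,\dots,a_n\ge0$, $$\lim_{p\to0^+}\ \sup_{x\ge p^{1/(2-k)}}\Bigl|\mathbb P_x\bigl(p^{\frac1{2-k}}V_1(p)\le a_1,\dots,p^{\frac1{2-k}}V_n(p)\le a_n\bigr)-\mathbb P_x\bigl(\overline V_1\le a_1,\dots,\overline V_n\le a_n\bigr)\Bigr|=0 .$$ -/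

import Mathlib

open MeasureTheory ProbabilityTheory Filter Topology
open scoped NNReal ENNReal

namespace TCPCompound

/-- The growth exponent of TCP Compound. -/
noncomputable def k : ℝ := 3 / 4

/-! ### The time to the first loss at packet error rate `p` -/

/-- Number of packets sent in the `i`-th round trip (`i = 0, 1, 2, …`) after starting, without
losses, from a window of `w` packets: the integer part of the solution at time `i` of the growth
equation `dW/dt = α W ^ k`, `W 0 = w`. -/
noncomputable def packetsInRound (α : ℝ) (w i : ℕ) : ℕ :=
  ⌊((w : ℝ) ^ (1 - k) + α * (1 - k) * i) ^ (1 / (1 - k))⌋₊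

/-- The first round trip in which some packet is lost; `ω (i, j)` records whether the `j`-th packet
of the `i`-th round trip is lost. -/
noncomputable def firstLossRound (α : ℝ) (w : ℕ) (ω : ℕ × ℕ → Bool) : ℕ :=
  sInf {i | ∃ j < packetsInRound α w i, ω (i, j) = true}

theorem measurable_firstLossRound (α : ℝ) (w : ℕ) : Measurable (firstLossRound α w) := by
  set B : ℕ → Set (ℕ × ℕ → Bool) :=
    fun i => {ω | ∃ j < packetsInRound α w i, ω (i, j) = true} with hB
  have hBm : ∀ i, MeasurableSet (B i) := by
    intro i
    have : B i = ⋃ j, ⋃ (_ : j < packetsInRound α w i), {ω | ω (i, j) = true} := by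
      ext ω; simp [hB]
    rw [this]
    refine MeasurableSet.iUnion fun j => MeasurableSet.iUnion fun _ => ?_
    exact (measurable_pi_apply (i, j) : Measurable fun ω : ℕ × ℕ → Bool => ω (i, j))
      (measurableSet_singleton true)
  refine measurable_to_countable' fun m => ?_
  have key : firstLossRound α w ⁻¹' {m} =
      (B m ∩ ⋂ i, ⋂ (_ : i < m), (B i)ᶜ) ∪ ({_ω | m = 0} ∩ ⋂ i, (B i)ᶜ) := by
    ext ω
    simp only [Set.mem_preimage, Set.mem_singleton_iff, Set.mem_union, Set.mem_inter_iff,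
      Set.mem_iInter, Set.mem_compl_iff, Set.mem_ofPred_eq]
    have hmem : ∀ i, ω ∈ B i ↔ i ∈ {i | ∃ j < packetsInRound α w i, ω (i, j) = true} :=
      fun i => Iff.rfl
    simp only [hmem, firstLossRound]
    set S := {i | ∃ j < packetsInRound α w i, ω (i, j) = true}
    constructor
    · rintro rfl
      by_cases hS : S.Nonempty
      · exact Or.inl ⟨Nat.sInf_mem hS, fun i hi => Nat.notMem_of_lt_sInf hi⟩
      · rw [Set.not_nonempty_iff_eq_empty] at hS
        right; simp [hS]
    · rintro (⟨h1, h2⟩ | ⟨rfl, h⟩)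
      · exact le_antisymm (Nat.sInf_le h1)
          (not_lt.1 fun hlt => h2 _ hlt (Nat.sInf_mem ⟨m, h1⟩))
      · rw [Set.eq_empty_of_forall_notMem h, Nat.sInf_empty]
  rw [key]
  refine ((hBm m).inter ?_).union ((MeasurableSet.const _).inter ?_)
  · exact MeasurableSet.iInter fun i => MeasurableSet.iInter fun _ => (hBm i).compl
  · exact MeasurableSet.iInter fun i => (hBm i).compl

/-- The law of `G^p_w`: packets are lost independently, each with probability `p`, and `G^p_w` is
the first round trip with a loss when the initial window is `w`. -/
noncomputable def lossTimeLaw (α : ℝ) (p : unitInterval) (w : ℕ) : Measure ℕ :=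
  (Measure.infinitePi fun _ : ℕ × ℕ => bernoulliMeasure true false p).map (firstLossRound α w)

instance (α : ℝ) (p : unitInterval) (w : ℕ) : IsProbabilityMeasure (lossTimeLaw α p w) :=
  Measure.isProbabilityMeasure_map (measurable_firstLossRound α w).aemeasurable

/-- The law of `G^p_w` as a kernel in the real window `v`, with `w = ⌊v⌋`. -/
noncomputable def lossTimeKernel (α : ℝ) (p : unitInterval) : Kernel ℝ ℝ where
  toFun v := (lossTimeLaw α p ⌊v⌋₊).map (fun m : ℕ => (m : ℝ))
  measurable' := (measurable_from_nat
    (f := fun w : ℕ => (lossTimeLaw α p w).map (fun m : ℕ => (m : ℝ)))).comp Nat.measurable_floor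

instance (α : ℝ) (p : unitInterval) : IsMarkovKernel (lossTimeKernel α p) :=
  ⟨fun _ => Measure.isProbabilityMeasure_map measurable_from_nat.aemeasurable⟩

/-! ### The limiting time to the first loss -/

/-- The complementary distribution function `y ↦ ℙ (Ḡ_x ≥ y)`, for `y ≥ 0`. -/
noncomputable def limitCcdf (α : ℝ) (x : ℝ≥0) (y : ℝ) : ℝ :=
  Real.exp (-(x * y) - 2 * α * (1 - k) * (x : ℝ) ^ k * y ^ 2
    - 2 * α ^ 2 * (1 - k) ^ 2 * (x : ℝ) ^ (2 * k - 1) * y ^ 3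
    - α ^ 3 * (1 - k) ^ 3 * (x : ℝ) ^ (3 * k - 2) * y ^ 4
    - α ^ 4 * (1 - k) ^ 4 * (x : ℝ) ^ (4 * k - 3) * y ^ 5 / 5)

theorem continuous_limitCcdf (α : ℝ) (x : ℝ≥0) : Continuous (limitCcdf α x) := by
  unfold limitCcdf; fun_prop

theorem limitCcdf_zero (α : ℝ) (x : ℝ≥0) : limitCcdf α x 0 = 1 := by
  simp [limitCcdf]

theorem limitCcdf_anti {α : ℝ} (hα : 0 < α) (x : ℝ≥0) {y z : ℝ} (hy : 0 ≤ y) (hyz : y ≤ z) :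
    limitCcdf α x z ≤ limitCcdf α x y := by
  have hk : (0 : ℝ) ≤ 1 - k := by norm_num [k]
  unfold limitCcdf
  apply Real.exp_le_exp.2
  gcongr

theorem tendsto_limitCcdf {α : ℝ} (hα : 0 < α) (x : ℝ≥0) :
    Tendsto (limitCcdf α x) atTop (𝓝 0) := by
  have hk : (0 : ℝ) < 1 - k := by norm_num [k]
  have hk4 : 4 * k - 3 = 0 := by norm_num [k]
  have hc : 0 < α ^ 4 * (1 - k) ^ 4 / 5 := by positivity
  have h1 : Tendsto (fun y : ℝ => Real.exp (-(α ^ 4 * (1 - k) ^ 4 / 5 * y ^ 5))) atTop (𝓝 0) :=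
    Real.tendsto_exp_neg_atTop_nhds_zero.comp
      ((tendsto_pow_atTop (by norm_num : (5 : ℕ) ≠ 0)).const_mul_atTop hc)
  refine tendsto_of_tendsto_of_tendsto_of_le_of_le' tendsto_const_nhds h1
    (Eventually.of_forall fun y => (Real.exp_pos _).le) ?_
  filter_upwards [eventually_ge_atTop 0] with y hy
  unfold limitCcdf
  apply Real.exp_le_exp.2
  rw [hk4, Real.rpow_zero]
  have e1 : 0 ≤ (x : ℝ) * y := by positivity
  have e2 : 0 ≤ 2 * α * (1 - k) * (x : ℝ) ^ k * y ^ 2 := by positivity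
  have e3 : 0 ≤ 2 * α ^ 2 * (1 - k) ^ 2 * (x : ℝ) ^ (2 * k - 1) * y ^ 3 := by positivity
  have e4 : 0 ≤ α ^ 3 * (1 - k) ^ 3 * (x : ℝ) ^ (3 * k - 2) * y ^ 4 := by positivity
  have e5 : α ^ 4 * (1 - k) ^ 4 * 1 * y ^ 5 / 5 = α ^ 4 * (1 - k) ^ 4 / 5 * y ^ 5 := by ring
  linarith

/-- The distribution function of `Ḡ_x`, equal to `0` on negative arguments. -/
noncomputable def limitCdf {α : ℝ} (hα : 0 < α) (x : ℝ≥0) : StieltjesFunction ℝ where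
  toFun y := 1 - limitCcdf α x (max y 0)
  mono' _ _ h := sub_le_sub_left
    (limitCcdf_anti hα x (le_max_right _ 0) (max_le_max_right 0 h)) 1
  right_continuous' _ := (continuous_const.sub ((continuous_limitCcdf α x).comp
    (continuous_id.max continuous_const))).continuousWithinAt

theorem limitCdf_apply {α : ℝ} (hα : 0 < α) (x : ℝ≥0) (y : ℝ) :
    limitCdf hα x y = 1 - limitCcdf α x (max y 0) := rfl

theorem tendsto_limitCdf_atBot {α : ℝ} (hα : 0 < α) (x : ℝ≥0) :
    Tendsto (limitCdf hα x) atBot (𝓝 0) := by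
  refine tendsto_const_nhds.congr' ?_
  filter_upwards [eventually_le_atBot 0] with y hy
  rw [limitCdf_apply, max_eq_right hy, limitCcdf_zero, sub_self]

theorem tendsto_limitCdf_atTop {α : ℝ} (hα : 0 < α) (x : ℝ≥0) :
    Tendsto (limitCdf hα x) atTop (𝓝 1) := by
  have h : Tendsto (fun y : ℝ => 1 - limitCcdf α x y) atTop (𝓝 (1 - 0)) :=
    tendsto_const_nhds.sub (tendsto_limitCcdf hα x)
  rw [sub_zero] at h
  refine h.congr' ?_
  filter_upwards [eventually_ge_atTop 0] with y hy
  rw [limitCdf_apply, max_eq_left hy]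

/-- The law of `Ḡ_x`. -/
noncomputable def limitTimeLaw {α : ℝ} (hα : 0 < α) (x : ℝ≥0) : Measure ℝ :=
  (limitCdf hα x).measure

instance {α : ℝ} (hα : 0 < α) (x : ℝ≥0) : IsProbabilityMeasure (limitTimeLaw hα x) :=
  (limitCdf hα x).isProbabilityMeasure (tendsto_limitCdf_atBot hα x) (tendsto_limitCdf_atTop hα x)

/-- `limitTimeLaw` has the complementary distribution function `limitCcdf`. -/
theorem limitTimeLaw_Ici {α : ℝ} (hα : 0 < α) (x : ℝ≥0) {y : ℝ} (hy : 0 ≤ y) :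
    limitTimeLaw hα x (Set.Ici y) = ENNReal.ofReal (limitCcdf α x y) := by
  have hc : ContinuousAt (limitCdf hα x) y :=
    (continuous_const.sub ((continuous_limitCcdf α x).comp
      (continuous_id.max continuous_const))).continuousAt
  rw [limitTimeLaw, (limitCdf hα x).measure_Ici (tendsto_limitCdf_atTop hα x),
    hc.continuousWithinAt.leftLim_eq, limitCdf_apply, max_eq_left hy, sub_sub_cancel]

theorem measurable_limitTimeLaw {α : ℝ} (hα : 0 < α) : Measurable (limitTimeLaw hα) := by
  refine .measure_of_isPiSystem_of_isProbabilityMeasure (borel_eq_generateFrom_Iic ℝ)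
    isPiSystem_Iic ?_
  rintro _ ⟨y, rfl⟩
  simp only [limitTimeLaw, StieltjesFunction.measure_Iic _ (tendsto_limitCdf_atBot hα _), sub_zero,
    limitCdf_apply, limitCcdf]
  fun_prop

/-- The law of `Ḡ_v` as a kernel in `v` (only `v ≥ 0` matters). -/
noncomputable def limitTimeKernel {α : ℝ} (hα : 0 < α) : Kernel ℝ ℝ where
  toFun v := limitTimeLaw hα v.toNNReal
  measurable' := (measurable_limitTimeLaw hα).comp measurable_real_toNNReal

instance {α : ℝ} (hα : 0 < α) : IsMarkovKernel (limitTimeKernel hα) :=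
  ⟨fun _ => inferInstanceAs (IsProbabilityMeasure (limitTimeLaw _ _))⟩

/-! ### The Markov chains of window sizes just after the losses -/

/-- The window just after a loss that occurs `t` round trips after the window was `v`. -/
noncomputable def postLossWindow (α β v t : ℝ) : ℝ :=
  (1 - β) * (v ^ (1 - k) + α * (1 - k) * t) ^ (1 / (1 - k))

/-- The transition kernel of `V_{n+1} = postLossWindow α β V_n G`, where, given the past, `G` has
the law `g V_n`. -/
noncomputable def windowKernel (α β : ℝ) (g : Kernel ℝ ℝ) : Kernel ℝ ℝ :=
  (Kernel.id ×ₖ g).map (fun q : ℝ × ℝ => postLossWindow α β q.1 q.2)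

instance (α β : ℝ) (g : Kernel ℝ ℝ) [IsMarkovKernel g] : IsMarkovKernel (windowKernel α β g) :=
  Kernel.IsMarkovKernel.map _ (by unfold postLossWindow; fun_prop)

/-- The law, on the space of trajectories, of the Markov chain with transition kernel `κ` started
at `v`. -/
noncomputable def chainLaw (κ : Kernel ℝ ℝ) [IsMarkovKernel κ] (v : ℝ) : Measure (ℕ → ℝ) :=
  Kernel.traj (X := fun _ => ℝ)
    (fun n => κ.comap (fun h : (i : Finset.Iic n) → ℝ => h ⟨n, Finset.mem_Iic.2 le_rfl⟩)
      (measurable_pi_apply _)) 0 (fun _ => v)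

/-- The law of the chain `V_0(p), V_1(p), …` started at `v`. -/
noncomputable def lossChainLaw (α β : ℝ) (p : unitInterval) (v : ℝ) : Measure (ℕ → ℝ) :=
  chainLaw (windowKernel α β (lossTimeKernel α p)) v

/-- The law of the chain `V̄_0, V̄_1, …` started at `v`. -/
noncomputable def limitChainLaw {α : ℝ} (hα : 0 < α) (β v : ℝ) : Measure (ℕ → ℝ) :=
  chainLaw (windowKernel α β (limitTimeKernel hα)) v

end TCPCompound

/-! With `k = 3/4`, windows are best described by their fourth root: from `A ^ 4` the window grows
without losses as `(A + α t / 4) ^ 4`, linearly in this coordinate. The exponent of the limiting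
survival function is then the integral of `(ξ + α s / 4) ^ 4` over `[0, y]`, that is `4 / (5 α) *
((ξ + α y / 4) ^ 5 - ξ ^ 5)` (`limitCcdf_pow_four`). Writing `p = η ^ 5`, windows scale by `p ^ (1 /
(2 - k)) = η ^ 4`, hence their fourth roots by `η`.

One step: the number `N` of packets sent before a given round is a Riemann sum of that integral, so
`p N` is within `O(η)` of the limiting exponent, and `(1 - p) ^ N` is within `O(η)` of the limiting
survival probability. The constant depends only on an upper bound for the thresholds, not on the
starting window (`exists_abs_survival_sub_le`, `exists_windowKernel_Iic_le`).

Iteration: the limiting chain is stochastically monotone, so its joint probability of staying below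
given levels is an antitone function of the starting point. By the layer-cake formula, integrals of
such a function against two laws differ by at most the largest difference of their distribution
functions (`lintegral_le_add_of_antitone`). No regularity in the starting point is needed, and
induction on `n` gives an error `K η` uniform in the starting point (`exists_boundedIter_le`). -/

namespace TCPCompound

/-! ### Iterated restricted transitions and the Markov property -/

/-- The restricted transition operator `g ↦ (x ↦ 𝔼[g X₁; X₁ ≤ b | X₀ = x])`. -/
noncomputable def boundedStep (κ : Kernel ℝ ℝ) (b : ℝ) (g : ℝ → ℝ≥0∞) (x : ℝ) : ℝ≥0∞ :=
  ∫⁻ y, (Set.Iic b).indicator g y ∂κ x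

/-- The operator `g ↦ (x ↦ 𝔼[g Xₙ; X₁ ≤ a 0, …, Xₙ ≤ a (n - 1) | X₀ = x])`. -/
noncomputable def boundedIter (κ : Kernel ℝ ℝ) : ℕ → (ℕ → ℝ) → (ℝ → ℝ≥0∞) → ℝ → ℝ≥0∞
  | 0, _, g => g
  | n + 1, a, g => boundedStep κ (a 0) (boundedIter κ n (fun i => a (i + 1)) g)

theorem boundedIter_succ (κ : Kernel ℝ ℝ) (n : ℕ) (a : ℕ → ℝ) (g : ℝ → ℝ≥0∞) :
    boundedIter κ (n + 1) a g =
      boundedStep κ (a 0) (boundedIter κ n (fun i => a (i + 1)) g) := rfl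

/-- The trajectory measure is extended at its last time, whereas the comparison of the chains
conditions on the first step; this passes from one to the other. -/
theorem boundedIter_succ' (κ : Kernel ℝ ℝ) (n : ℕ) (a : ℕ → ℝ) (g : ℝ → ℝ≥0∞) :
    boundedIter κ (n + 1) a g = boundedIter κ n a (boundedStep κ (a n) g) := by
  induction n generalizing a with
  | zero => rfl
  | succ n ih => rw [boundedIter_succ, ih, ← boundedIter_succ]

theorem measurable_boundedStep (κ : Kernel ℝ ℝ) (b : ℝ) {g : ℝ → ℝ≥0∞} (hg : Measurable g) :
    Measurable (boundedStep κ b g) :=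
  (hg.indicator measurableSet_Iic).lintegral_kernel

theorem measurable_boundedIter (κ : Kernel ℝ ℝ) (n : ℕ) (a : ℕ → ℝ) {g : ℝ → ℝ≥0∞}
    (hg : Measurable g) : Measurable (boundedIter κ n a g) := by
  induction n generalizing a with
  | zero => exact hg
  | succ n ih => exact measurable_boundedStep κ _ (ih _)

theorem boundedStep_le_one (κ : Kernel ℝ ℝ) [IsMarkovKernel κ] (b : ℝ) {g : ℝ → ℝ≥0∞}
    (hg : ∀ x, g x ≤ 1) (x : ℝ) : boundedStep κ b g x ≤ 1 := by
  calc boundedStep κ b g x ≤ ∫⁻ _, 1 ∂κ x :=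
        lintegral_mono fun y => (Set.indicator_le_self _ _ y).trans (hg y)
    _ = 1 := by simp

theorem boundedIter_le_one (κ : Kernel ℝ ℝ) [IsMarkovKernel κ] (n : ℕ) (a : ℕ → ℝ)
    {g : ℝ → ℝ≥0∞} (hg : ∀ x, g x ≤ 1) (x : ℝ) : boundedIter κ n a g x ≤ 1 := by
  induction n generalizing a x with
  | zero => exact hg x
  | succ n ih => exact boundedStep_le_one κ _ (ih _) x

theorem measurableSet_forall_lt_le (n : ℕ) (a : ℕ → ℝ) :
    MeasurableSet {V : ℕ → ℝ | ∀ i < n, V (i + 1) ≤ a i} := by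
  have : {V : ℕ → ℝ | ∀ i < n, V (i + 1) ≤ a i} =
      ⋂ i, ⋂ (_ : i < n), {V : ℕ → ℝ | V (i + 1) ≤ a i} := by
    ext V; simp
  rw [this]
  exact MeasurableSet.iInter fun i => MeasurableSet.iInter fun _ =>
    measurableSet_le (measurable_pi_apply _) measurable_const

instance (κ : Kernel ℝ ℝ) [IsMarkovKernel κ] (v : ℝ) : IsProbabilityMeasure (chainLaw κ v) := by
  unfold chainLaw; infer_instance

/-- The Markov property at time `n`. -/
theorem lintegral_chainLaw_succ (κ : Kernel ℝ ℝ) [IsMarkovKernel κ] (v : ℝ) (n : ℕ)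
    {f : ((i : Finset.Iic n) → ℝ) → ℝ → ℝ≥0∞} (hf : Measurable (Function.uncurry f)) :
    ∫⁻ V, f (fun i => V i) (V (n + 1)) ∂chainLaw κ v =
      ∫⁻ V, ∫⁻ y, f (fun i => V i) y ∂κ (V n) ∂chainLaw κ v := by
  have h := Kernel.partialTraj_compProd_eq_map_traj (X := fun _ => ℝ)
    (κ := fun n => κ.comap (fun h : (i : Finset.Iic n) → ℝ => h ⟨n, Finset.mem_Iic.2 le_rfl⟩)
      (measurable_pi_apply _)) (Nat.zero_le n) (x₀ := fun _ => v)
  have hm : Measurable (Preorder.frestrictLe (π := fun _ : ℕ => ℝ) n) :=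
    Preorder.measurable_frestrictLe n
  calc ∫⁻ V, f (fun i => V i) (V (n + 1)) ∂chainLaw κ v
      = ∫⁻ q, Function.uncurry f q ∂((chainLaw κ v).map
          fun V => (Preorder.frestrictLe (π := fun _ : ℕ => ℝ) n V, V (n + 1))) := by
        rw [lintegral_map hf (hm.prodMk (measurable_pi_apply _))]; rfl
    _ = _ := by
        rw [chainLaw, ← h, Measure.lintegral_compProd hf, ← Kernel.traj_map_frestrictLe_apply,
          lintegral_map hf.lintegral_kernel_prod_right' hm]
        rfl

/-- A general terminal function `g` makes the induction work: the Markov property absorbs the last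
transition into `g`. -/
theorem lintegral_chainLaw_indicator (κ : Kernel ℝ ℝ) [IsMarkovKernel κ] (v : ℝ) (n : ℕ)
    (a : ℕ → ℝ) {g : ℝ → ℝ≥0∞} (hg : Measurable g) :
    ∫⁻ V, {V : ℕ → ℝ | ∀ i < n, V (i + 1) ≤ a i}.indicator (fun V => g (V n)) V ∂chainLaw κ v =
      boundedIter κ n a g v := by
  induction n generalizing g with
  | zero =>
    have h0 : (chainLaw κ v).map (fun V => V 0) = Measure.dirac v := by
      have h := Kernel.traj_map_frestrictLe_apply (X := fun _ => ℝ)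
        (κ := fun n => κ.comap (fun h : (i : Finset.Iic n) → ℝ => h ⟨n, Finset.mem_Iic.2 le_rfl⟩)
        (measurable_pi_apply _)) 0 0 (fun _ => v)
      rw [Kernel.partialTraj_self, Kernel.id_apply] at h
      have hm : Measurable fun h : (i : Finset.Iic 0) → ℝ => h ⟨0, by simp⟩ :=
        measurable_pi_apply _
      have h2 := congrArg (Measure.map fun h : (i : Finset.Iic 0) → ℝ => h ⟨0, by simp⟩) h
      rw [Measure.map_map hm (Preorder.measurable_frestrictLe (X := fun _ => ℝ) 0),
        Measure.map_dirac' hm] at h2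
      exact h2
    have : ∫⁻ V, g (V 0) ∂chainLaw κ v = g v := by
      rw [← lintegral_map (f := g) hg (measurable_pi_apply 0), h0, lintegral_dirac' _ hg]
    simpa [boundedIter] using this
  | succ n ih =>
    rw [boundedIter_succ', ← ih (measurable_boundedStep κ _ hg)]
    -- The event of the first `n` constraints, as a set of histories up to time `n`, which is the
    -- form that `lintegral_chainLaw_succ` takes.
    set S : Set ((i : Finset.Iic n) → ℝ) :=
      {h | ∀ i, ∀ hi : i < n, h ⟨i + 1, Finset.mem_Iic.2 hi⟩ ≤ a i} with hS
    have hSm : MeasurableSet S := by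
      have : S = ⋂ i, ⋂ hi : i < n, {h | h ⟨i + 1, Finset.mem_Iic.2 hi⟩ ≤ a i} := by
        ext h; simp [hS]
      rw [this]
      exact MeasurableSet.iInter fun i => MeasurableSet.iInter fun _ =>
        measurableSet_le (measurable_pi_apply _) measurable_const
    have hmem : ∀ V : ℕ → ℝ, (fun i : Finset.Iic n => V i) ∈ S ↔ ∀ i < n, V (i + 1) ≤ a i :=
      fun V => Iff.rfl
    have hf : Measurable (Function.uncurry fun (h : (i : Finset.Iic n) → ℝ) (y : ℝ) =>
        S.indicator (fun _ => (Set.Iic (a n)).indicator g y) h) := by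
      have : (Function.uncurry fun (h : (i : Finset.Iic n) → ℝ) (y : ℝ) =>
          S.indicator (fun _ => (Set.Iic (a n)).indicator g y) h) =
          (Prod.fst ⁻¹' S).indicator fun q => (Set.Iic (a n)).indicator g q.2 := by
        ext ⟨h, y⟩; simp [Function.uncurry, Set.indicator]
      rw [this]
      exact ((hg.indicator measurableSet_Iic).comp measurable_snd).indicator
        (measurable_fst hSm)
    have key := lintegral_chainLaw_succ κ v n hf
    convert! key using 1
    · refine lintegral_congr fun V => ?_
      classical
      simp only [Set.indicator_apply, hmem, Set.mem_ofPred_eq, Nat.forall_lt_succ_right,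
        Set.mem_Iic, ite_and]
    · refine lintegral_congr fun V => ?_
      by_cases h : ∀ i < n, V (i + 1) ≤ a i
      · have h' : (fun i : Finset.Iic n => V i) ∈ S := h
        simp only [Set.indicator_of_mem h']
        rw [Set.indicator_of_mem (by exact h)]
        rfl
      · have h' : (fun i : Finset.Iic n => V i) ∉ S := h
        simp only [Set.indicator_of_notMem h']
        rw [Set.indicator_of_notMem (by exact h)]
        simp

theorem chainLaw_forall_lt_le (κ : Kernel ℝ ℝ) [IsMarkovKernel κ] (v : ℝ) (n : ℕ) (a : ℕ → ℝ) :
    chainLaw κ v {V | ∀ i < n, V (i + 1) ≤ a i} = boundedIter κ n a (fun _ => 1) v := by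
  rw [← lintegral_chainLaw_indicator κ v n a measurable_const,
    lintegral_indicator_const (measurableSet_forall_lt_le n a), one_mul]

/-! ### Comparison of integrals of antitone functions -/

/-- A nonempty lower set bounded above is a closed or an open half-line; the open one is an
increasing union of closed ones. -/
theorem measure_le_add_of_isLowerSet {μ ν : Measure ℝ} {δ : ℝ≥0∞}
    {a : ℝ} (h : ∀ b ≤ a, μ (Set.Iic b) ≤ ν (Set.Iic b) + δ) {S : Set ℝ} (hS : IsLowerSet S)
    (hSa : S ⊆ Set.Iic a) : μ S ≤ ν S + δ := by
  rcases S.eq_empty_or_nonempty with rfl | hne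
  · simp
  have hbdd : BddAbove S := ⟨a, hSa⟩
  have hsup : sSup S ≤ a := csSup_le hne hSa
  by_cases hmem : sSup S ∈ S
  · have : S = Set.Iic (sSup S) :=
      Set.Subset.antisymm (fun y hy => le_csSup hbdd hy) fun y hy => hS hy hmem
    rw [this]; exact h _ hsup
  · have hlt : ∀ y ∈ S, y < sSup S := fun y hy =>
      lt_of_le_of_ne (le_csSup hbdd hy) fun e => hmem (e ▸ hy)
    have hU : S = ⋃ n : ℕ, Set.Iic (sSup S - 1 / ((n : ℝ) + 1)) := by
      ext y
      simp only [Set.mem_iUnion, Set.mem_Iic]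
      constructor
      · intro hy
        obtain ⟨n, hn⟩ := exists_nat_one_div_lt (sub_pos.2 (hlt y hy))
        exact ⟨n, by linarith⟩
      · rintro ⟨n, hn⟩
        have : (0 : ℝ) < 1 / ((n : ℝ) + 1) := by positivity
        obtain ⟨z, hz, hyz⟩ := exists_lt_of_lt_csSup hne (show y < sSup S by linarith)
        exact hS hyz.le hz
    have hmono : Monotone fun n : ℕ => Set.Iic (sSup S - 1 / ((n : ℝ) + 1)) := by
      intro m n hmn
      refine Set.Iic_subset_Iic.2 (sub_le_sub_left ?_ _)
      gcongr
    have hle : ∀ n : ℕ, μ (Set.Iic (sSup S - 1 / ((n : ℝ) + 1))) ≤ ν S + δ := fun n => by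
      have : (0 : ℝ) < 1 / ((n : ℝ) + 1) := by positivity
      refine (h _ (by linarith)).trans (add_le_add_left (measure_mono ?_) δ)
      intro y hy
      rw [hU]; exact Set.mem_iUnion.2 ⟨n, hy⟩
    conv_lhs => rw [hU]
    rw [hmono.measure_iUnion]
    exact iSup_le hle

/-- Layer cake: the level sets `{g > t}` with `0 < t < 1` are lower sets inside `Iic a`, so each
costs at most `δ`, and `t` ranges over an interval of length one. -/
theorem lintegral_le_add_of_antitone {μ ν : Measure ℝ} {δ : ℝ≥0∞}
    {a : ℝ} (h : ∀ b ≤ a, μ (Set.Iic b) ≤ ν (Set.Iic b) + δ) {g : ℝ → ℝ≥0∞} (hg : Antitone g)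
    (hg1 : ∀ y, g y ≤ 1) (hga : ∀ y, a < y → g y = 0) : ∫⁻ y, g y ∂μ ≤ ∫⁻ y, g y ∂ν + δ := by
  have htop : ∀ y, g y ≠ ∞ := fun y => ((hg1 y).trans_lt ENNReal.one_lt_top).ne
  set f : ℝ → ℝ := fun y => (g y).toReal with hf
  have hfanti : Antitone f := fun x y hxy => ENNReal.toReal_mono (htop x) (hg hxy)
  have hgf : ∀ y, g y = ENNReal.ofReal (f y) := fun y => (ENNReal.ofReal_toReal (htop y)).symm
  have hf1 : ∀ y, f y ≤ 1 := fun y =>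
    ENNReal.toReal_le_of_le_ofReal zero_le_one (by simpa using hg1 y)
  have hlayer : ∀ ρ : Measure ℝ, ∫⁻ y, g y ∂ρ = ∫⁻ t in Set.Ioo 0 1, ρ {y | t < f y} := by
    intro ρ
    simp_rw [hgf]
    rw [lintegral_eq_lintegral_meas_lt ρ (ae_of_all _ fun y => ENNReal.toReal_nonneg)
      hfanti.measurable.aemeasurable, ← lintegral_indicator measurableSet_Ioi,
      ← lintegral_indicator measurableSet_Ioo]
    refine lintegral_congr fun t => ?_
    by_cases ht0 : 0 < t
    · by_cases ht1 : t < 1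
      · rw [Set.indicator_of_mem (by exact ht0), Set.indicator_of_mem (by exact ⟨ht0, ht1⟩)]
      · rw [Set.indicator_of_mem (by exact ht0),
          Set.indicator_of_notMem (by exact fun hh => ht1 hh.2)]
        have : {y | t < f y} = ∅ :=
          Set.eq_empty_of_forall_notMem fun y hy => ht1 (lt_of_lt_of_le hy (hf1 y))
        rw [this, measure_empty]
    · rw [Set.indicator_of_notMem (by exact ht0),
        Set.indicator_of_notMem (by exact fun hh => ht0 hh.1)]
  rw [hlayer μ, hlayer ν]
  calc ∫⁻ t in Set.Ioo 0 1, μ {y | t < f y}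
      ≤ ∫⁻ t in Set.Ioo (0 : ℝ) 1, (ν {y | t < f y} + δ) := by
        refine setLIntegral_mono' measurableSet_Ioo fun t ht => ?_
        refine measure_le_add_of_isLowerSet h
          (fun y z hzy (hy : t < f y) => lt_of_lt_of_le hy (hfanti hzy)) fun y hy => ?_
        by_contra hya
        have : f y = 0 := by simp [hf, hga y (not_le.1 hya)]
        exact absurd hy (by simpa [this] using ht.1.le)
    _ = _ := by
        rw [lintegral_add_right _ measurable_const]
        simp

/-! ### One-step distribution functions -/

theorem postLossWindow_eq (α β v t : ℝ) :
    postLossWindow α β v t = (1 - β) * (v ^ (1 / 4 : ℝ) + α / 4 * t) ^ 4 := by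
  have h1 : (1 - k : ℝ) = 1 / 4 := by norm_num [k]
  rw [postLossWindow, h1, show (1 / (1 / 4) : ℝ) = (4 : ℕ) by norm_num, Real.rpow_natCast]
  ring

theorem postLossWindow_nonneg {β : ℝ} (hβ : β < 1) (α v t : ℝ) : 0 ≤ postLossWindow α β v t := by
  rw [postLossWindow_eq]
  have : 0 < 1 - β := sub_pos.2 hβ
  positivity

theorem pow_four_rpow {ξ : ℝ} (hξ : 0 ≤ ξ) : (ξ ^ 4) ^ (1 / 4 : ℝ) = ξ := by
  rw [← Real.rpow_natCast, ← Real.rpow_mul hξ]; norm_num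

/-- Growth is linear in the fourth root, so a bound on the post-loss window is a bound on the loss
time. This is why windows are written `ξ ^ 4` and thresholds `(1 - β) * u ^ 4` from here on. -/
theorem postLossWindow_le_iff {α β ξ t u : ℝ} (hα : 0 < α) (hβ : β < 1) (hξ : 0 ≤ ξ) (ht : 0 ≤ t)
    (hu : 0 ≤ u) :
    postLossWindow α β (ξ ^ 4) t ≤ (1 - β) * u ^ 4 ↔ t ≤ 4 / α * (u - ξ) := by
  rw [postLossWindow_eq, pow_four_rpow hξ, mul_le_mul_iff_of_pos_left (sub_pos.2 hβ),
    pow_le_pow_iff_left₀ (by positivity) hu (by norm_num), div_mul_eq_mul_div 4 α,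
    le_div_iff₀ hα]
  constructor <;> intro h <;> linarith

theorem measurable_postLossWindow (α β v : ℝ) : Measurable (postLossWindow α β v) := by
  unfold postLossWindow; fun_prop

theorem windowKernel_apply (α β : ℝ) (g : Kernel ℝ ℝ) [IsMarkovKernel g] (v : ℝ) {S : Set ℝ}
    (hS : MeasurableSet S) :
    windowKernel α β g v S = g v {t | postLossWindow α β v t ∈ S} := by
  have hm : Measurable fun q : ℝ × ℝ => postLossWindow α β q.1 q.2 := by
    unfold postLossWindow; fun_prop
  rw [windowKernel, Kernel.map_apply' _ hm _ hS, Kernel.prod_apply, Kernel.id_apply,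
    Measure.dirac_prod, Measure.map_apply measurable_prodMk_left (hm hS)]
  rfl

theorem windowKernel_Iio_zero (α : ℝ) {β : ℝ} (hβ : β < 1) (g : Kernel ℝ ℝ) [IsMarkovKernel g]
    (v : ℝ) : windowKernel α β g v (Set.Iio 0) = 0 := by
  rw [windowKernel_apply _ _ _ _ measurableSet_Iio]
  have : {t | postLossWindow α β v t ∈ Set.Iio 0} = ∅ :=
    Set.eq_empty_of_forall_notMem fun t ht => (postLossWindow_nonneg hβ α v t).not_gt ht
  rw [this, measure_empty]

/-- The limiting survival function in the coordinate `w ↦ w ^ (1/4)` on windows. -/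
theorem limitCcdf_pow_four {α ξ y : ℝ} (hα : 0 < α) (hξ : 0 ≤ ξ) :
    limitCcdf α (ξ ^ 4).toNNReal y =
      Real.exp (-(4 / (5 * α) * ((ξ + α / 4 * y) ^ 5 - ξ ^ 5))) := by
  -- The exponents `k`, `2k - 1`, `3k - 2`, `4k - 3` are `m / 4` for `m = 3, 2, 1, 0`. What remains
  -- is the binomial expansion of a difference of fifth powers.
  have hp : ∀ m : ℕ, (ξ ^ 4) ^ ((m : ℝ) / 4) = ξ ^ m := by
    intro m
    rw [← Real.rpow_natCast ξ 4, ← Real.rpow_mul hξ, ← Real.rpow_natCast ξ m]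
    congr 1; push_cast; ring
  have h3 := hp 3
  have h2 := hp 2
  have h1 := hp 1
  have h0 := hp 0
  unfold limitCcdf
  rw [Real.coe_toNNReal _ (by positivity), show k = ((3 : ℕ) : ℝ) / 4 by norm_num [k], h3,
    show 2 * (((3 : ℕ) : ℝ) / 4) - 1 = ((2 : ℕ) : ℝ) / 4 by norm_num, h2,
    show 3 * (((3 : ℕ) : ℝ) / 4) - 2 = ((1 : ℕ) : ℝ) / 4 by norm_num, h1,
    show 4 * (((3 : ℕ) : ℝ) / 4) - 3 = ((0 : ℕ) : ℝ) / 4 by norm_num, h0]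
  congr 1
  field_simp
  push_cast
  ring

theorem limitTimeLaw_Iic {α : ℝ} (hα : 0 < α) (x : ℝ≥0) (y : ℝ) :
    limitTimeLaw hα x (Set.Iic y) = ENNReal.ofReal (1 - limitCcdf α x (max y 0)) := by
  rw [limitTimeLaw, StieltjesFunction.measure_Iic _ (tendsto_limitCdf_atBot hα x), sub_zero,
    limitCdf_apply]

/-- The maximum with `0` covers `u < ξ`, where the event would need a negative loss time and so is
null. -/
theorem limitWindowKernel_Iic {α β ξ u : ℝ} (hα : 0 < α) (hβ : β < 1) (hξ : 0 ≤ ξ) (hu : 0 ≤ u) :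
    windowKernel α β (limitTimeKernel hα) (ξ ^ 4) (Set.Iic ((1 - β) * u ^ 4)) =
      ENNReal.ofReal (1 - Real.exp (-max (4 / (5 * α) * (u ^ 5 - ξ ^ 5)) 0)) := by
  rw [windowKernel_apply _ _ _ _ measurableSet_Iic]
  change limitTimeLaw hα (ξ ^ 4).toNNReal _ = _
  have h0 : limitTimeLaw hα (ξ ^ 4).toNNReal (Set.Ici 0)ᶜ = 0 := by
    rw [prob_compl_eq_zero_iff measurableSet_Ici, limitTimeLaw_Ici hα _ le_rfl, limitCcdf_zero,
      ENNReal.ofReal_one]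
  have hae : {t | postLossWindow α β (ξ ^ 4) t ∈ Set.Iic ((1 - β) * u ^ 4)}
      =ᵐ[limitTimeLaw hα (ξ ^ 4).toNNReal] Set.Iic (4 / α * (u - ξ)) := by
    have : ∀ᵐ t ∂limitTimeLaw hα (ξ ^ 4).toNNReal, 0 ≤ t := h0
    filter_upwards [this] with t ht
    exact propext (postLossWindow_le_iff hα hβ hξ ht hu)
  rw [measure_congr hae, limitTimeLaw_Iic, limitCcdf_pow_four hα hξ]
  congr 4
  rcases le_total u ξ with h | h
  · rw [max_eq_right (mul_nonpos_of_nonneg_of_nonpos (by positivity) (by linarith)),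
      max_eq_right]
    · ring
    · exact mul_nonpos_of_nonneg_of_nonpos (by positivity)
        (sub_nonpos.2 (pow_le_pow_left₀ hu h 5))
  · rw [max_eq_left (mul_nonneg (by positivity) (by linarith)), max_eq_left]
    · congr 2
      field_simp
      ring
    · exact mul_nonneg (by positivity) (sub_nonneg.2 (pow_le_pow_left₀ hξ h 5))

/-- The number of packets sent up to the `m`-th round trip, excluded. -/
noncomputable def packetsBefore (α : ℝ) (w m : ℕ) : ℕ := ∑ i ∈ Finset.range m, packetsInRound α w i

/-- The probability that no packet is lost in the first `m` round trips. -/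
theorem infinitePi_noLoss (α : ℝ) (p : unitInterval) (w m : ℕ) :
    (Measure.infinitePi fun _ : ℕ × ℕ => bernoulliMeasure true false p)
      {ω | ∀ i < m, ∀ j < packetsInRound α w i, ω (i, j) = false} =
      ENNReal.ofReal ((1 - (p : ℝ)) ^ packetsBefore α w m) := by
  classical
  set s : Finset (ℕ × ℕ) := ((Finset.range m).sigma fun i =>
    Finset.range (packetsInRound α w i)).map (Equiv.sigmaEquivProd ℕ ℕ).toEmbedding with hs
  have hset : {ω : ℕ × ℕ → Bool | ∀ i < m, ∀ j < packetsInRound α w i, ω (i, j) = false} =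
      Set.pi s fun _ => {false} := by
    ext ω
    simp only [Set.mem_ofPred_eq, Set.mem_pi, hs, Set.mem_singleton_iff]
    constructor
    · rintro h ⟨i, j⟩ hq
      have hq' : i < m ∧ j < packetsInRound α w i := by simpa using hq
      exact h i hq'.1 j hq'.2
    · intro h i hi j hj
      exact h (i, j) (by simp [hi, hj])
  have hcard : s.card = packetsBefore α w m := by
    simp [hs, packetsBefore]
  have h1 : bernoulliMeasure true false p {false} = ENNReal.ofReal (1 - (p : ℝ)) := by
    rw [bernoulliMeasure_apply_of_notMem_of_mem p (by simp) (by simp) (by simp)]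
    rw [ENNReal.ofReal]
    congr 1
    ext
    rw [Real.coe_toNNReal _ (sub_nonneg.2 p.2.2)]
    rfl
  rw [hset, Measure.infinitePi_pi _ fun _ _ => measurableSet_singleton _, Finset.prod_const, h1,
    hcard, ENNReal.ofReal_pow (sub_nonneg.2 p.2.2)]

theorem packetsInRound_eq (α : ℝ) (w i : ℕ) :
    packetsInRound α w i = ⌊((w : ℝ) ^ (1 / 4 : ℝ) + α / 4 * i) ^ 4⌋₊ := by
  have h1 : (1 - k : ℝ) = 1 / 4 := by norm_num [k]
  rw [packetsInRound, h1, show (1 / (1 / 4) : ℝ) = (4 : ℕ) by norm_num, Real.rpow_natCast]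
  congr 2; ring

theorem tendsto_packetsInRound {α : ℝ} (hα : 0 < α) (w : ℕ) :
    Tendsto (packetsInRound α w) atTop atTop := by
  have : packetsInRound α w =
      fun i : ℕ => ⌊((w : ℝ) ^ (1 / 4 : ℝ) + α / 4 * i) ^ 4⌋₊ :=
    funext (packetsInRound_eq α w)
  rw [this]
  refine tendsto_nat_floor_atTop.comp ((tendsto_pow_atTop (by norm_num)).comp ?_)
  exact tendsto_atTop_add_const_left _ _
    (tendsto_natCast_atTop_atTop.const_mul_atTop (by positivity))

theorem tendsto_packetsBefore {α : ℝ} (hα : 0 < α) (w : ℕ) :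
    Tendsto (packetsBefore α w) atTop atTop := by
  refine (tendsto_add_atTop_iff_nat 1).1 ?_
  refine tendsto_atTop_mono (fun m => ?_) (tendsto_packetsInRound hα w)
  rw [packetsBefore, Finset.sum_range_succ]
  exact Nat.le_add_left _ _

theorem lossTimeLaw_Iio {α : ℝ} (hα : 0 < α) {p : unitInterval} (hp : 0 < (p : ℝ)) (w m : ℕ) :
    lossTimeLaw α p w {i | i < m} =
      ENNReal.ofReal (1 - (1 - (p : ℝ)) ^ packetsBefore α w m) := by
  have hp1 : (0 : ℝ) ≤ 1 - p := sub_nonneg.2 p.2.2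
  set P := Measure.infinitePi fun _ : ℕ × ℕ => bernoulliMeasure true false p with hP
  set N : ℕ → Set (ℕ × ℕ → Bool) :=
    fun m => {ω | ∀ i < m, ∀ j < packetsInRound α w i, ω (i, j) = false} with hN
  have hPN : ∀ m, P (N m) = ENNReal.ofReal ((1 - (p : ℝ)) ^ packetsBefore α w m) :=
    infinitePi_noLoss α p w
  have hNm : ∀ m, MeasurableSet (N m) := by
    intro m
    have : N m = ⋂ i, ⋂ (_ : i < m), ⋂ j, ⋂ (_ : j < packetsInRound α w i),
        {ω | ω (i, j) = false} := by
      ext ω; simp [hN]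
    rw [this]
    exact MeasurableSet.iInter fun i => MeasurableSet.iInter fun _ => MeasurableSet.iInter fun j =>
      MeasurableSet.iInter fun _ =>
        (measurable_pi_apply (i, j) : Measurable fun ω : ℕ × ℕ → Bool => ω (i, j))
          (measurableSet_singleton false)
  -- On a run without any loss `firstLossRound` takes the default value `sInf ∅ = 0`, which would
  -- wrongly count as a loss in round `0`. Such runs are null because the number of packets sent
  -- tends to infinity.
  have hnull : P (⋂ m, N m) = 0 := by
    have hlim : Tendsto (fun m => ENNReal.ofReal ((1 - (p : ℝ)) ^ packetsBefore α w m)) atTop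
        (𝓝 0) := by
      have := ENNReal.tendsto_ofReal ((tendsto_pow_atTop_nhds_zero_of_lt_one hp1
        (by linarith)).comp (tendsto_packetsBefore hα w))
      simpa using this
    refine le_antisymm (ge_of_tendsto' hlim fun m => ?_) zero_le
    rw [← hPN]
    exact measure_mono (Set.iInter_subset _ m)
  have hae : (firstLossRound α w ⁻¹' {i | i < m} : Set (ℕ × ℕ → Bool)) =ᵐ[P]
      ((N m)ᶜ : Set (ℕ × ℕ → Bool)) := by
    have : ∀ᵐ ω ∂P, ω ∉ ⋂ m, N m := measure_eq_zero_iff_ae_notMem.1 hnull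
    filter_upwards [this] with ω hω
    refine propext ?_
    change firstLossRound α w ω < m ↔ ¬ω ∈ N m
    have hne : {i | ∃ j < packetsInRound α w i, ω (i, j) = true}.Nonempty := by
      by_contra hcon
      rw [Set.not_nonempty_iff_eq_empty] at hcon
      refine hω (Set.mem_iInter.2 fun m i _ j hj => ?_)
      by_contra hne
      have : i ∈ {i | ∃ j < packetsInRound α w i, ω (i, j) = true} :=
        ⟨j, hj, by simpa using hne⟩
      rw [hcon] at this
      exact this
    constructor
    · intro hlt hmem
      obtain ⟨j, hj, hjt⟩ := Nat.sInf_mem hne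
      exact absurd ((hmem _ hlt j hj).symm.trans hjt) (by simp)
    · intro hmem
      simp only [hN, Set.mem_ofPred_eq, not_forall] at hmem
      obtain ⟨i, hi, j, hj, hij⟩ := hmem
      exact (Nat.sInf_le (show i ∈ {i | ∃ j < packetsInRound α w i, ω (i, j) = true} from
        ⟨j, hj, by simpa using hij⟩)).trans_lt hi
  rw [lossTimeLaw, Measure.map_apply (measurable_firstLossRound α w) (.of_discrete), ← hP,
    measure_congr hae, prob_compl_eq_one_sub (hNm m), hPN, ← ENNReal.ofReal_one,
    ENNReal.ofReal_sub _ (by positivity)]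

/-- An integer is at most `4 / α * (U - A)` exactly when it is less than the floor plus one. If `U <
A` no round qualifies, and zero rounds give probability `0`. -/
theorem lossWindowKernel_Iic {α β A U : ℝ} (hα : 0 < α) (hβ : β < 1) {p : unitInterval}
    (hp : 0 < (p : ℝ)) (hA : 0 ≤ A) (hU : 0 ≤ U) :
    windowKernel α β (lossTimeKernel α p) (A ^ 4) (Set.Iic ((1 - β) * U ^ 4)) =
      ENNReal.ofReal (1 - (1 - (p : ℝ)) ^ packetsBefore α ⌊A ^ 4⌋₊
        (if A ≤ U then ⌊4 / α * (U - A)⌋₊ + 1 else 0)) := by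
  rw [windowKernel_apply _ _ _ _ measurableSet_Iic, ← lossTimeLaw_Iio hα hp]
  change (lossTimeLaw α p ⌊A ^ 4⌋₊).map (fun m : ℕ => (m : ℝ)) _ = _
  have hS : MeasurableSet {t | postLossWindow α β (A ^ 4) t ∈ Set.Iic ((1 - β) * U ^ 4)} :=
    measurable_postLossWindow α β _ measurableSet_Iic
  rw [Measure.map_apply measurable_from_nat hS]
  congr 1
  ext m
  simp only [Set.mem_preimage, Set.mem_ofPred_eq, Set.mem_Iic]
  rw [postLossWindow_le_iff hα hβ hA m.cast_nonneg hU]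
  split_ifs with h
  · rw [Nat.lt_succ_iff, Nat.le_floor_iff (mul_nonneg (by positivity) (by linarith))]
  · have : 4 / α * (U - A) < 0 := mul_neg_of_pos_of_neg (by positivity) (by linarith)
    have hm : (0 : ℝ) ≤ m := m.cast_nonneg
    constructor
    · intro; linarith
    · intro h; exact absurd h (by simp)

/-! ### Comparison of the one-step distribution functions -/

/-- The right-hand side is the mean of `s ^ 4` over `[z, z + d]`. This bound and the next compare it
with the two endpoint values, hence an integral with its left and right Riemann sums. -/
theorem pow_four_le_fifth_diff {d z : ℝ} (hd : 0 < d) (hz : 0 ≤ z) :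
    z ^ 4 ≤ 1 / (5 * d) * ((z + d) ^ 5 - z ^ 5) := by
  rw [one_div, ← div_eq_inv_mul, le_div_iff₀ (by positivity)]
  have : 0 ≤ 10 * z ^ 3 * d ^ 2 + 10 * z ^ 2 * d ^ 3 + 5 * z * d ^ 4 + d ^ 5 := by positivity
  nlinarith

theorem fifth_diff_le_pow_four {d z : ℝ} (hd : 0 < d) (hz : 0 ≤ z) :
    1 / (5 * d) * ((z + d) ^ 5 - z ^ 5) ≤ (z + d) ^ 4 := by
  rw [one_div, ← div_eq_inv_mul, div_le_iff₀ (by positivity)]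
  have : 0 ≤ 10 * z ^ 3 * d ^ 2 + 20 * z ^ 2 * d ^ 3 + 15 * z * d ^ 4 + 4 * d ^ 5 := by positivity
  nlinarith

theorem packetsBefore_le {α A : ℝ} (hα : 0 < α) (hA : 0 ≤ A) (m : ℕ) :
    (packetsBefore α ⌊A ^ 4⌋₊ m : ℝ) ≤
      1 / (5 * (α / 4)) * ((A + α / 4 * m) ^ 5 - A ^ 5) := by
  have hB : ((⌊A ^ 4⌋₊ : ℝ)) ^ (1 / 4 : ℝ) ≤ A := by
    calc ((⌊A ^ 4⌋₊ : ℝ)) ^ (1 / 4 : ℝ) ≤ (A ^ 4) ^ (1 / 4 : ℝ) :=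
          Real.rpow_le_rpow (by positivity) (Nat.floor_le (by positivity)) (by norm_num)
      _ = A := pow_four_rpow hA
  induction m with
  | zero => simp [packetsBefore]
  | succ m ih =>
    have h1 : (packetsInRound α ⌊A ^ 4⌋₊ m : ℝ) ≤ (A + α / 4 * m) ^ 4 := by
      rw [packetsInRound_eq]
      refine (Nat.floor_le (by positivity)).trans ?_
      gcongr
    have h2 := pow_four_le_fifth_diff (d := α / 4) (z := A + α / 4 * m) (by positivity)
      (by positivity)
    rw [packetsBefore, Finset.sum_range_succ, ← packetsBefore]
    push_cast
    rw [show A + α / 4 * ((m : ℝ) + 1) = A + α / 4 * m + α / 4 by ring]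
    linarith

/-- Right Riemann sum over rounds `1` to `m`: round `0` is only bounded below by zero, and each
floor costs at most one packet. -/
theorem le_packetsBefore_succ {α : ℝ} (hα : 0 < α) (w m : ℕ) :
    1 / (5 * (α / 4)) * (((w : ℝ) ^ (1 / 4 : ℝ) + α / 4 * m) ^ 5 - ((w : ℝ) ^ (1 / 4 : ℝ)) ^ 5)
      - (m + 1) ≤ packetsBefore α w (m + 1) := by
  induction m with
  | zero =>
    have : (0 : ℝ) ≤ packetsBefore α w (0 + 1) := Nat.cast_nonneg _
    simp only [Nat.cast_zero, mul_zero, add_zero, sub_self, zero_add] at this ⊢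
    linarith
  | succ m ih =>
    have h1 : ((w : ℝ) ^ (1 / 4 : ℝ) + α / 4 * ((m + 1 : ℕ) : ℝ)) ^ 4 - 1 ≤
        packetsInRound α w (m + 1) := by
      rw [packetsInRound_eq]
      exact (Nat.sub_one_lt_floor _).le
    have h2 := fifth_diff_le_pow_four (d := α / 4) (z := (w : ℝ) ^ (1 / 4 : ℝ) + α / 4 * m)
      (by positivity) (by positivity)
    rw [packetsBefore, Finset.sum_range_succ, ← packetsBefore]
    push_cast at h1 ⊢
    rw [show (w : ℝ) ^ (1 / 4 : ℝ) + α / 4 * ((m : ℝ) + 1) =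
      (w : ℝ) ^ (1 / 4 : ℝ) + α / 4 * m + α / 4 by ring] at h1 ⊢
    linarith

theorem abs_fifth_sub_le {R y z : ℝ} (hy : |y| ≤ R) (hz : |z| ≤ R) :
    |y ^ 5 - z ^ 5| ≤ 5 * R ^ 4 * |y - z| := by
  refine (abs_pow_sub_pow_le y z 5).trans ?_
  have : max |y| |z| ^ 4 ≤ R ^ 4 :=
    pow_le_pow_left₀ (le_max_of_le_left (abs_nonneg y)) (max_le hy hz) 4
  have h2 := mul_le_mul_of_nonneg_left this (abs_nonneg (y - z))
  norm_num
  linarith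

/-- The mean number of losses until the first loss compared to its limit, in the case of windows
that do not exceed the threshold. -/
theorem abs_packetsBefore_sub_le {α A ξ η u R : ℝ} (hα : 0 < α) (hA : 0 ≤ A) (hξ : 0 ≤ ξ)
    (hη : 0 < η) (hη1 : η ≤ 1) (hu : 0 ≤ u) (huR : u + 1 + α / 4 ≤ R) (hξA : |ξ - η * A| ≤ η)
    (hAu : A ≤ u / η) :
    |η ^ 5 * packetsBefore α ⌊A ^ 4⌋₊ (⌊4 / α * (u / η - A)⌋₊ + 1)
        - 4 / (5 * α) * (u ^ 5 - ξ ^ 5)| ≤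
      (4 / (5 * α) * (5 * R ^ 4 * (2 + α / 4)) + (R / (α / 4) + 1)) * η := by
  set U := u / η with hUdef
  have huU : u = η * U := by rw [hUdef]; field_simp
  have hU : 0 ≤ U := by positivity
  set m := ⌊4 / α * (U - A)⌋₊ with hm
  have harg : 0 ≤ 4 / α * (U - A) := mul_nonneg (by positivity) (by linarith)
  have hm1 : α / 4 * m ≤ U - A := by
    have := mul_le_mul_of_nonneg_left (Nat.floor_le harg) (by positivity : 0 ≤ α / 4)
    rwa [← mul_assoc, show α / 4 * (4 / α) = 1 by field_simp, one_mul] at this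
  have hm2 : U - A ≤ α / 4 * m + α / 4 := by
    have := mul_le_mul_of_nonneg_left (Nat.lt_floor_add_one (4 / α * (U - A))).le
      (by positivity : 0 ≤ α / 4)
    rw [← mul_assoc, show α / 4 * (4 / α) = 1 by field_simp, one_mul] at this
    linarith
  set c := 4 / (5 * α) with hc
  have hc' : 1 / (5 * (α / 4)) = c := by rw [hc]; field_simp
  have hc0 : 0 < c := by positivity
  set B := ((⌊A ^ 4⌋₊ : ℝ)) ^ (1 / 4 : ℝ) with hB
  have hB0 : 0 ≤ B := by positivity
  have hB4 : B ^ 4 = ⌊A ^ 4⌋₊ := by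
    rw [hB, ← Real.rpow_natCast, ← Real.rpow_mul (by positivity)]; norm_num
  have hBA : B ≤ A := by
    refine le_of_pow_le_pow_left₀ (n := 4) (by norm_num) hA ?_
    rw [hB4]; exact Nat.floor_le (by positivity)
  have hAB : A ≤ B + 1 := by
    -- Rounding the window down lowers its fourth root by at most one, since `B ^ 4 + 1 ≤ (B + 1) ^
    -- 4`.
    refine le_of_pow_le_pow_left₀ (n := 4) (by norm_num) (by positivity) ?_
    have h1 := (Nat.lt_floor_add_one (A ^ 4)).le
    rw [← hB4] at h1
    have : 0 ≤ 4 * B ^ 3 + 6 * B ^ 2 + 4 * B := by positivity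
    nlinarith
  have hup := packetsBefore_le hα hA (m + 1)
  have hlo := le_packetsBefore_succ hα ⌊A ^ 4⌋₊ m
  rw [hc'] at hup hlo
  rw [← hB] at hlo
  set N : ℝ := (packetsBefore α ⌊A ^ 4⌋₊ (m + 1) : ℝ) with hN
  have hodd : Monotone fun z : ℝ => z ^ 5 := (Odd.strictMono_pow (by decide)).monotone
  have hup2 : N ≤ c * ((U + α / 4) ^ 5 - A ^ 5) := by
    refine hup.trans (mul_le_mul_of_nonneg_left (sub_le_sub_right (hodd ?_) _) hc0.le)
    push_cast; linarith
  -- In `1 + α / 4`, the `1` comes from `A ≤ B + 1` and the `α / 4` from the floor defining `m`.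
  have hlo2 : c * ((U - (1 + α / 4)) ^ 5 - A ^ 5) - (U / (α / 4) + 1) ≤ N := by
    refine le_trans (sub_le_sub (mul_le_mul_of_nonneg_left (sub_le_sub (hodd ?_) (hodd hBA))
      hc0.le) ?_) hlo
    · linarith
    · have : (m : ℝ) ≤ U / (α / 4) := by
        rw [le_div_iff₀ (by positivity)]; linarith
      linarith
  -- Multiplying by `η ^ 5` scales all fourth roots by `η`: the bounded shifts above become shifts
  -- of order `η` between points of `[-R, R]`, where `z ↦ z ^ 5` is `5 * R ^ 4`-Lipschitz. The
  -- floors in the packet counts cost only `O(η ^ 4)`.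
  have hη5 : 0 ≤ η ^ 5 := by positivity
  have hup3 : η ^ 5 * N ≤ c * ((u + η * (α / 4)) ^ 5 - (η * A) ^ 5) := by
    have := mul_le_mul_of_nonneg_left hup2 hη5
    calc _ ≤ _ := this
      _ = _ := by rw [huU]; ring
  have hlo3 : c * ((u - η * (1 + α / 4)) ^ 5 - (η * A) ^ 5) - η ^ 4 * (u / (α / 4) + η) ≤
      η ^ 5 * N := by
    have := mul_le_mul_of_nonneg_left hlo2 hη5
    calc _ = _ := by rw [huU]; ring
      _ ≤ _ := this
  have hηA : η * A ≤ u := by rw [huU]; exact mul_le_mul_of_nonneg_left hAu hη.le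
  have hηA0 : 0 ≤ η * A := by positivity
  have hd : 0 < α / 4 := by positivity
  have hR : 0 ≤ R := by linarith
  obtain ⟨hξ1, hξ2⟩ := abs_le.1 hξA
  have hηd : η * (α / 4) ≤ α / 4 := by nlinarith
  have hηd0 : 0 ≤ η * (α / 4) := by positivity
  have hRu : |u| ≤ R := by rw [abs_of_nonneg hu]; linarith
  have e1 := abs_fifth_sub_le (R := R) (y := u + η * (α / 4)) (z := u)
    (by rw [abs_of_nonneg (by positivity)]; linarith) hRu
  have e2 := abs_fifth_sub_le (R := R) (y := u - η * (1 + α / 4)) (z := u)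
    (abs_le.2 ⟨by linarith, by linarith⟩) hRu
  have e3 := abs_fifth_sub_le (R := R) (y := ξ) (z := η * A)
    (by rw [abs_of_nonneg hξ]; linarith) (by rw [abs_of_nonneg hηA0]; linarith)
  rw [add_sub_cancel_left, abs_of_nonneg hηd0] at e1
  rw [sub_sub_cancel_left, abs_neg,
    abs_of_nonneg (show 0 ≤ η * (1 + α / 4) by positivity)] at e2
  have hR4 : 0 ≤ 5 * R ^ 4 := by positivity
  have e3' := e3.trans (mul_le_mul_of_nonneg_left hξA hR4)
  have hη4 : η ^ 4 * (u / (α / 4) + η) ≤ (R / (α / 4) + 1) * η := by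
    have h1 : η ^ 4 ≤ η := by
      simpa using pow_le_pow_of_le_one hη.le hη1 (show 1 ≤ 4 by norm_num)
    have h2 : u / (α / 4) + η ≤ R / (α / 4) + 1 := by
      gcongr
      linarith
    rw [mul_comm (R / (α / 4) + 1)]
    exact mul_le_mul h1 h2 (by positivity) hη.le
  rw [abs_le] at e1 e2 e3' ⊢
  have k1 := mul_le_mul_of_nonneg_left e1.2 hc0.le
  have k2 := mul_le_mul_of_nonneg_left e2.1 hc0.le
  have k3 := mul_le_mul_of_nonneg_left e3'.2 hc0.le
  have k4 := mul_le_mul_of_nonneg_left e3'.1 hc0.le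
  have k5 : 0 ≤ c * (5 * R ^ 4 * η) := by positivity
  have k6 : 0 ≤ (R / (α / 4) + 1) * η := by positivity
  constructor
  · linarith
  · linarith

/-- If the window already exceeds the threshold, the packet count is zero and `ξ > u - η`, so the
limiting exponent is `O(η)`. Here `A` and `ξ` may be arbitrarily large, which gives the uniformity
over starting windows. -/
theorem abs_packetsBefore_sub_max_le {α A ξ η u R : ℝ} (hα : 0 < α) (hA : 0 ≤ A) (hξ : 0 ≤ ξ)
    (hη : 0 < η) (hη1 : η ≤ 1) (hu : 0 ≤ u) (huR : u + 1 + α / 4 ≤ R) (hξA : |ξ - η * A| ≤ η) :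
    |η ^ 5 * packetsBefore α ⌊A ^ 4⌋₊ (if A ≤ u / η then ⌊4 / α * (u / η - A)⌋₊ + 1 else 0)
        - max (4 / (5 * α) * (u ^ 5 - ξ ^ 5)) 0| ≤
      (4 / (5 * α) * (5 * R ^ 4 * (2 + α / 4)) + (R / (α / 4) + 1)) * η := by
  have hd : 0 < α / 4 := by positivity
  have hR : 0 ≤ R := by linarith
  split_ifs with h
  · refine le_trans ?_ (abs_packetsBefore_sub_le hα hA hξ hη hη1 hu huR hξA h)
    set q := η ^ 5 * (packetsBefore α ⌊A ^ 4⌋₊ (⌊4 / α * (u / η - A)⌋₊ + 1) : ℝ)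
    have hq : 0 ≤ q := by positivity
    calc _ = |max q 0 - max (4 / (5 * α) * (u ^ 5 - ξ ^ 5)) 0| := by rw [max_eq_left hq]
      _ ≤ _ := abs_max_sub_max_le_abs _ _ _
  · have hlt : u < η * A := by rw [not_le, div_lt_iff₀ hη] at h; linarith
    have hrhs : 4 / (5 * α) * (5 * R ^ 4 * η) ≤
        (4 / (5 * α) * (5 * R ^ 4 * (2 + α / 4)) + (R / (α / 4) + 1)) * η := by
      have h1 : 0 ≤ 4 / (5 * α) * (5 * R ^ 4 * (1 + α / 4)) * η := by positivity
      have h2 : 0 ≤ (R / (α / 4) + 1) * η := by positivity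
      linarith
    refine le_trans ?_ hrhs
    simp only [packetsBefore, Finset.range_zero, Finset.sum_empty, Nat.cast_zero, mul_zero,
      zero_sub, abs_neg]
    rw [abs_of_nonneg (le_max_right _ _)]
    refine max_le ?_ (by positivity)
    refine mul_le_mul_of_nonneg_left ?_ (by positivity)
    rcases le_total u ξ with hle | hle
    · have := pow_le_pow_left₀ hu hle 5
      have : 0 ≤ 5 * R ^ 4 * η := by positivity
      linarith
    · have e := (le_abs_self _).trans (abs_fifth_sub_le (R := R) (y := u) (z := ξ)
        (by rw [abs_of_nonneg hu]; linarith) (by rw [abs_of_nonneg hξ]; linarith))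
      refine e.trans (mul_le_mul_of_nonneg_left ?_ (by positivity))
      rw [abs_of_nonneg (sub_nonneg.2 hle)]
      linarith [(abs_le.1 hξA).1]

theorem abs_exp_neg_sub_exp_neg_le {s t : ℝ} (hs : 0 ≤ s) (ht : 0 ≤ t) :
    |Real.exp (-s) - Real.exp (-t)| ≤ |s - t| := by
  wlog h : s ≤ t generalizing s t
  · rw [abs_sub_comm, abs_sub_comm s]; exact this ht hs (le_of_not_ge h)
  rw [abs_of_nonneg (sub_nonneg.2 (Real.exp_le_exp.2 (neg_le_neg h))), abs_sub_comm,
    abs_of_nonneg (sub_nonneg.2 h)]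
  have h1 : Real.exp (-t) = Real.exp (-s) * Real.exp (s - t) := by
    rw [← Real.exp_add]; congr 1; ring
  have h2 : s - t + 1 ≤ Real.exp (s - t) := Real.add_one_le_exp _
  have h3 : Real.exp (-s) ≤ 1 := Real.exp_le_one_iff.2 (by linarith)
  have h4 := Real.exp_pos (-s)
  rw [h1]
  nlinarith

/-- The bases `1 - p` and `exp (-p)` differ by at most `p ^ 2` and are at most one, so each of the
`N` factors contributes at most `p ^ 2`. -/
theorem abs_one_sub_pow_sub_exp_le {p : ℝ} (hp0 : 0 ≤ p) (hp1 : p ≤ 1) (N : ℕ) :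
    |(1 - p) ^ N - Real.exp (-(p * N))| ≤ p * (p * N) := by
  have h1 : Real.exp (-(p * N)) = Real.exp (-p) ^ N := by
    rw [← Real.exp_nat_mul]; congr 1; ring
  have h2 : |Real.exp (-p) - 1 - -p| ≤ (-p) ^ 2 :=
    Real.abs_exp_sub_one_sub_id_le (by rwa [abs_neg, abs_of_nonneg hp0])
  have h3 : max |1 - p| |Real.exp (-p)| ≤ 1 := by
    refine max_le (abs_le.2 ⟨by linarith, by linarith⟩) ?_
    rw [abs_of_pos (Real.exp_pos _)]
    exact Real.exp_le_one_iff.2 (by linarith)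
  have h4 : |1 - p - Real.exp (-p)| ≤ p ^ 2 := by
    rw [abs_sub_comm]
    calc _ = |Real.exp (-p) - 1 - -p| := by congr 1; ring
      _ ≤ _ := h2
      _ = _ := by ring
  rw [h1]
  calc _ ≤ |1 - p - Real.exp (-p)| * N * max |1 - p| |Real.exp (-p)| ^ (N - 1) :=
        abs_pow_sub_pow_le _ _ _
    _ ≤ |1 - p - Real.exp (-p)| * N * 1 :=
        mul_le_mul_of_nonneg_left
          (pow_le_one₀ (le_max_of_le_left (abs_nonneg _)) h3) (by positivity)
    _ ≤ p ^ 2 * N := by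
        rw [mul_one]; exact mul_le_mul_of_nonneg_right h4 N.cast_nonneg
    _ = _ := by ring

/-- The survival functions of the two chains after one step are uniformly close. -/
theorem exists_abs_survival_sub_le {α : ℝ} (hα : 0 < α) (r : ℝ) :
    ∃ K, 0 ≤ K ∧ ∀ A ξ η u : ℝ, 0 ≤ A → 0 ≤ ξ → 0 < η → η ≤ 1 → 0 ≤ u → u ≤ r →
      |ξ - η * A| ≤ η →
      |(1 - η ^ 5) ^ packetsBefore α ⌊A ^ 4⌋₊
            (if A ≤ u / η then ⌊4 / α * (u / η - A)⌋₊ + 1 else 0)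
        - Real.exp (-max (4 / (5 * α) * (u ^ 5 - ξ ^ 5)) 0)| ≤ K * η := by
  set R := |r| + 1 + α / 4 with hR
  set K₁ := 4 / (5 * α) * (5 * R ^ 4 * (2 + α / 4)) + (R / (α / 4) + 1) with hK₁
  have hR0 : 0 ≤ R := by positivity
  have hK₁0 : 0 ≤ K₁ := by positivity
  -- The first two terms bound `p N`, the cost of replacing `(1 - p) ^ N` by `exp (-p N)`; the last
  -- `K₁` is the cost of replacing `p N` by the limiting exponent.
  refine ⟨4 / (5 * α) * R ^ 5 + K₁ + K₁, by positivity, ?_⟩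
  intro A ξ η u hA hξ hη hη1 hu hur hξA
  have huR : u + 1 + α / 4 ≤ R := by linarith [le_abs_self r]
  set N := packetsBefore α ⌊A ^ 4⌋₊ (if A ≤ u / η then ⌊4 / α * (u / η - A)⌋₊ + 1 else 0) with hN
  have h1 : |η ^ 5 * N - max (4 / (5 * α) * (u ^ 5 - ξ ^ 5)) 0| ≤ K₁ * η :=
    abs_packetsBefore_sub_max_le hα hA hξ hη hη1 hu huR hξA
  set T := max (4 / (5 * α) * (u ^ 5 - ξ ^ 5)) 0 with hT
  have hT0 : 0 ≤ T := le_max_right _ _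
  have hTR : T ≤ 4 / (5 * α) * R ^ 5 := by
    refine max_le (mul_le_mul_of_nonneg_left ?_ (by positivity)) (by positivity)
    have := pow_le_pow_left₀ hu (show u ≤ R by linarith) 5
    have : 0 ≤ ξ ^ 5 := by positivity
    linarith
  have hp1 : η ^ 5 ≤ 1 := pow_le_one₀ hη.le hη1
  have hpη : η ^ 5 ≤ η := by
    simpa using pow_le_pow_of_le_one hη.le hη1 (show 1 ≤ 5 by norm_num)
  have hq0 : 0 ≤ η ^ 5 * (N : ℝ) := by positivity
  have hq : η ^ 5 * (N : ℝ) ≤ 4 / (5 * α) * R ^ 5 + K₁ := by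
    have := (abs_le.1 h1).2
    nlinarith
  have h2 := abs_one_sub_pow_sub_exp_le (by positivity) hp1 N
  have h3 := (abs_exp_neg_sub_exp_neg_le hq0 hT0).trans h1
  have h4 : η ^ 5 * (η ^ 5 * N) ≤ η * (4 / (5 * α) * R ^ 5 + K₁) :=
    mul_le_mul hpη hq hq0 hη.le
  calc _ ≤ _ := abs_sub_le _ (Real.exp (-(η ^ 5 * N))) _
    _ ≤ _ := by linarith

/-! ### Comparison of the two chains -/

/-- The fourth root is subadditive. This turns a rounding error `η ^ 4` on scaled windows into an
error `η` on their fourth roots. -/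
theorem abs_sub_le_of_abs_pow_four_sub_le {s t η : ℝ} (hs : 0 ≤ s) (ht : 0 ≤ t) (hη : 0 ≤ η)
    (h : |s ^ 4 - t ^ 4| ≤ η ^ 4) : |s - t| ≤ η := by
  wlog hst : t ≤ s generalizing s t
  · rw [abs_sub_comm]
    exact this ht hs (by rwa [abs_sub_comm]) (le_of_not_ge hst)
  rw [abs_of_nonneg (sub_nonneg.2 hst)]
  by_contra! hlt
  have h1 : (t + η) ^ 4 < s ^ 4 := pow_lt_pow_left₀ (by linarith) (by positivity) (by norm_num)
  have h2 := (le_abs_self _).trans h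
  have h3 : 0 ≤ 4 * t ^ 3 * η + 6 * t ^ 2 * η ^ 2 + 4 * t * η ^ 3 := by positivity
  nlinarith

theorem exists_rpow_quarter {x : ℝ} (hx : 0 ≤ x) : ∃ ξ, 0 ≤ ξ ∧ ξ ^ 4 = x :=
  ⟨x ^ (1 / 4 : ℝ), by positivity, by
    rw [← Real.rpow_natCast, ← Real.rpow_mul hx]; norm_num⟩

theorem ofReal_one_sub_le {s t δ : ℝ} (hδ : 0 ≤ δ) (ht : t ≤ 1) (h : |s - t| ≤ δ) :
    ENNReal.ofReal (1 - s) ≤ ENNReal.ofReal (1 - t) + ENNReal.ofReal δ := by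
  rw [← ENNReal.ofReal_add (sub_nonneg.2 ht) hδ]
  exact ENNReal.ofReal_le_ofReal (by linarith [(abs_le.1 h).1])

/-- The distribution functions of the two chains after one step are uniformly close. -/
theorem exists_windowKernel_Iic_le {α β : ℝ} (hα : 0 < α) (hβ : β < 1) (a : ℝ) :
    ∃ K, 0 ≤ K ∧ ∀ (p : unitInterval) (η v x b : ℝ), 0 < η → (p : ℝ) = η ^ 5 → 0 ≤ v → 0 ≤ x →
      |x - η ^ 4 * v| ≤ η ^ 4 → b ≤ a →
      ((windowKernel α β (lossTimeKernel α p) v).map (fun y => η ^ 4 * y) (Set.Iic b) ≤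
          windowKernel α β (limitTimeKernel hα) x (Set.Iic b) + ENNReal.ofReal (K * η)) ∧
      (windowKernel α β (limitTimeKernel hα) x (Set.Iic b) ≤
        (windowKernel α β (lossTimeKernel α p) v).map (fun y => η ^ 4 * y) (Set.Iic b)
          + ENNReal.ofReal (K * η)) := by
  have hβ' : 0 < 1 - β := sub_pos.2 hβ
  obtain ⟨r, hr0, hr⟩ := exists_rpow_quarter (show 0 ≤ |a| / (1 - β) by positivity)
  obtain ⟨K, hK0, hK⟩ := exists_abs_survival_sub_le hα r
  refine ⟨K, hK0, ?_⟩
  intro p η v x b hη hpη hv hx hxv hba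
  have hη4 : 0 < η ^ 4 := by positivity
  have hpre : (fun y => η ^ 4 * y) ⁻¹' Set.Iic b = Set.Iic (b / η ^ 4) := by
    ext y; simp [le_div_iff₀ hη4, mul_comm]
  rw [Measure.map_apply (measurable_const_mul _) measurableSet_Iic, hpre]
  rcases lt_or_ge b 0 with hb | hb
  · have h1 : windowKernel α β (lossTimeKernel α p) v (Set.Iic (b / η ^ 4)) = 0 :=
      measure_mono_null (Set.Iic_subset_Iio.2 (div_neg_of_neg_of_pos hb hη4))
        (windowKernel_Iio_zero α hβ _ v)
    have h2 : windowKernel α β (limitTimeKernel hα) x (Set.Iic b) = 0 :=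
      measure_mono_null (Set.Iic_subset_Iio.2 hb) (windowKernel_Iio_zero α hβ _ x)
    rw [h1, h2]
    exact ⟨zero_le, zero_le⟩
  obtain ⟨u, hu0, hu⟩ := exists_rpow_quarter (show 0 ≤ b / (1 - β) by positivity)
  obtain ⟨A, hA0, rfl⟩ := exists_rpow_quarter hv
  obtain ⟨ξ, hξ0, rfl⟩ := exists_rpow_quarter hx
  have hbu : b = (1 - β) * u ^ 4 := by rw [hu]; field_simp
  have hbu' : b / η ^ 4 = (1 - β) * (u / η) ^ 4 := by rw [hbu]; field_simp
  have hur : u ≤ r := by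
    refine le_of_pow_le_pow_left₀ (n := 4) (by norm_num) hr0 ?_
    rw [hr, hu]
    exact div_le_div_of_nonneg_right (hba.trans (le_abs_self a)) hβ'.le
  have hη1 : η ≤ 1 := by
    refine le_of_pow_le_pow_left₀ (n := 5) (by norm_num) zero_le_one ?_
    rw [← hpη, one_pow]; exact p.2.2
  have hξA : |ξ - η * A| ≤ η :=
    abs_sub_le_of_abs_pow_four_sub_le hξ0 (by positivity) hη.le (by rwa [mul_pow])
  have hp0 : 0 < (p : ℝ) := by rw [hpη]; positivity
  have key := hK A ξ η u hA0 hξ0 hη hη1 hu0 hur hξA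
  rw [hbu', lossWindowKernel_Iic hα hβ hp0 hA0 (by positivity), hbu,
    limitWindowKernel_Iic hα hβ hξ0 hu0, hpη]
  refine ⟨ofReal_one_sub_le (by positivity) ?_ key,
    ofReal_one_sub_le (by positivity) ?_ (by rwa [abs_sub_comm])⟩
  · exact Real.exp_le_one_iff.2 (neg_nonpos.2 (le_max_right _ _))
  · rw [← hpη]; exact pow_le_one₀ (sub_nonneg.2 p.2.2) (by linarith)

/-- Monotonicity in the starting window is available only on `[0, ∞)`. Both measures live there, so
`g` may be replaced by `y ↦ g (max y 0)`, antitone on the whole line. -/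
theorem lintegral_indicator_Iic_le_add {μ ν : Measure ℝ} {δ : ℝ≥0∞} {a : ℝ}
    (hμ : μ (Set.Iio 0) = 0) (hν : ν (Set.Iio 0) = 0)
    (h : ∀ b ≤ a, μ (Set.Iic b) ≤ ν (Set.Iic b) + δ) {g : ℝ → ℝ≥0∞}
    (hg : AntitoneOn g (Set.Ici 0)) (hg1 : ∀ y, g y ≤ 1) :
    ∫⁻ y, (Set.Iic a).indicator g y ∂μ ≤ ∫⁻ y, (Set.Iic a).indicator g y ∂ν + δ := by
  have hcongr : ∀ ρ : Measure ℝ, ρ (Set.Iio 0) = 0 → ∫⁻ y, (Set.Iic a).indicator g y ∂ρ =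
      ∫⁻ y, (Set.Iic a).indicator (fun y => g (max y 0)) y ∂ρ := by
    intro ρ hρ
    have : ∀ᵐ y ∂ρ, y ∉ Set.Iio 0 := measure_eq_zero_iff_ae_notMem.1 hρ
    refine lintegral_congr_ae ?_
    filter_upwards [this] with y hy
    simp only [Set.indicator_apply, max_eq_left (Set.notMem_Iio.1 hy)]
  rw [hcongr μ hμ, hcongr ν hν]
  refine lintegral_le_add_of_antitone h (fun y z hyz => ?_) (fun y => ?_) fun y hy => ?_
  · by_cases hz : z ≤ a
    · rw [Set.indicator_of_mem (by exact hz), Set.indicator_of_mem (by exact hyz.trans hz)]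
      exact hg (Set.mem_Ici.2 (le_max_right _ _)) (Set.mem_Ici.2 (le_max_right _ _))
        (max_le_max_right 0 hyz)
    · rw [Set.indicator_of_notMem (by exact hz)]
      exact zero_le
  · exact (Set.indicator_le_self _ _ y).trans (hg1 _)
  · exact Set.indicator_of_notMem (by simpa using hy) _

/-- The limiting chain is stochastically monotone. -/
theorem limitWindowKernel_Iic_antitone {α β x x' : ℝ} (hα : 0 < α) (hβ : β < 1) (hx : 0 ≤ x)
    (hxx' : x ≤ x') (b : ℝ) :
    windowKernel α β (limitTimeKernel hα) x' (Set.Iic b) ≤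
      windowKernel α β (limitTimeKernel hα) x (Set.Iic b) := by
  have hβ' : 0 < 1 - β := sub_pos.2 hβ
  rcases lt_or_ge b 0 with hb | hb
  · rw [measure_mono_null (Set.Iic_subset_Iio.2 hb) (windowKernel_Iio_zero α hβ _ x')]
    exact zero_le
  obtain ⟨u, hu0, hu⟩ := exists_rpow_quarter (show 0 ≤ b / (1 - β) by positivity)
  obtain ⟨ξ', hξ'0, rfl⟩ := exists_rpow_quarter (hx.trans hxx')
  obtain ⟨ξ, hξ0, rfl⟩ := exists_rpow_quarter hx
  have hbu : b = (1 - β) * u ^ 4 := by rw [hu]; field_simp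
  have hle : ξ ≤ ξ' := le_of_pow_le_pow_left₀ (by norm_num) hξ'0 hxx'
  rw [hbu, limitWindowKernel_Iic hα hβ hξ0 hu0, limitWindowKernel_Iic hα hβ hξ'0 hu0]
  gcongr

/-- Stochastic monotonicity propagates through the comparison of integrals with `δ = 0`. -/
theorem antitoneOn_boundedIter_limit {α β : ℝ} (hα : 0 < α) (hβ : β < 1) (n : ℕ) (a : ℕ → ℝ) :
    AntitoneOn (boundedIter (windowKernel α β (limitTimeKernel hα)) n a fun _ => 1)
      (Set.Ici 0) := by
  induction n generalizing a with
  | zero => exact fun _ _ _ _ _ => le_rfl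
  | succ n ih =>
    intro x hx x' _ hxx'
    have := lintegral_indicator_Iic_le_add (δ := 0) (a := a 0)
      (windowKernel_Iio_zero α hβ (limitTimeKernel hα) x')
      (windowKernel_Iio_zero α hβ (limitTimeKernel hα) x)
      (fun b _ => by rw [add_zero]; exact limitWindowKernel_Iic_antitone hα hβ hx hxx' b)
      (ih fun i => a (i + 1)) (boundedIter_le_one _ n _ fun _ => le_rfl)
    rwa [add_zero] at this

/-- The error splits in two: after the first step, the functional `Gp` of the loss chain is replaced
by that of the limit, `G`, by induction; then the scaled one-step law is replaced by the limiting
one, against `G`. Only the limiting chain has to be monotone. -/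
theorem exists_boundedIter_le {α β : ℝ} (hα : 0 < α) (hβ : β < 1) (n : ℕ) (a : ℕ → ℝ) :
    ∃ K, 0 ≤ K ∧ ∀ (p : unitInterval) (η v x : ℝ), 0 < η → (p : ℝ) = η ^ 5 → 0 ≤ v → 0 ≤ x →
      |x - η ^ 4 * v| ≤ η ^ 4 →
      (boundedIter (windowKernel α β (lossTimeKernel α p)) n (fun i => a i / η ^ 4)
          (fun _ => 1) v ≤
        boundedIter (windowKernel α β (limitTimeKernel hα)) n a (fun _ => 1) x
          + ENNReal.ofReal (K * η)) ∧
      (boundedIter (windowKernel α β (limitTimeKernel hα)) n a (fun _ => 1) x ≤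
        boundedIter (windowKernel α β (lossTimeKernel α p)) n (fun i => a i / η ^ 4)
          (fun _ => 1) v + ENNReal.ofReal (K * η)) := by
  induction n generalizing a with
  | zero => exact ⟨0, le_rfl, fun p η v x _ _ _ _ _ => by simp [boundedIter]⟩
  | succ n ih =>
    obtain ⟨K₁, hK₁0, hK₁⟩ := ih fun i => a (i + 1)
    obtain ⟨K₂, hK₂0, hK₂⟩ := exists_windowKernel_Iic_le hα hβ (a 0)
    refine ⟨K₁ + K₂, by positivity, ?_⟩
    intro p η v x hη hpη hv hx hxv
    have hη4 : 0 < η ^ 4 := by positivity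
    set κ := windowKernel α β (limitTimeKernel hα)
    set κp := windowKernel α β (lossTimeKernel α p)
    set G := boundedIter κ n (fun i => a (i + 1)) fun _ => 1 with hG
    set Gp := boundedIter κp n (fun i => a (i + 1) / η ^ 4) fun _ => 1 with hGp
    have hGm : Measurable G := measurable_boundedIter _ _ _ measurable_const
    have hind : Measurable ((Set.Iic (a 0)).indicator G) := hGm.indicator measurableSet_Iic
    set δ₁ := ENNReal.ofReal (K₁ * η)
    set δ₂ := ENNReal.ofReal (K₂ * η)
    have hδ : ENNReal.ofReal ((K₁ + K₂) * η) = δ₁ + δ₂ := by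
      rw [add_mul, ENNReal.ofReal_add (by positivity) (by positivity)]
    have hclose : ∀ᵐ y ∂κp v, Gp y ≤ G (η ^ 4 * y) + δ₁ ∧ G (η ^ 4 * y) ≤ Gp y + δ₁ := by
      have : ∀ᵐ y ∂κp v, y ∉ Set.Iio 0 :=
        measure_eq_zero_iff_ae_notMem.1 (windowKernel_Iio_zero α hβ _ v)
      filter_upwards [this] with y hy
      have hy0 : 0 ≤ y := not_lt.1 hy
      -- The limiting chain restarts exactly at the scaled window, so no rounding error accumulates
      -- from step to step.
      exact hK₁ p η y (η ^ 4 * y) hη hpη hy0 (by positivity) (by simpa using hη4.le)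
    have hmem : ∀ y, y ∈ Set.Iic (a 0 / η ^ 4) ↔ η ^ 4 * y ∈ Set.Iic (a 0) := fun y => by
      rw [Set.mem_Iic, Set.mem_Iic, le_div_iff₀ hη4, mul_comm]
    set μ := (κp v).map fun y => η ^ 4 * y with hμdef
    have hmap : ∫⁻ z, (Set.Iic (a 0)).indicator G z ∂μ =
        ∫⁻ y, (Set.Iic (a 0)).indicator G (η ^ 4 * y) ∂κp v :=
      lintegral_map hind (measurable_const_mul _)
    have hμ0 : μ (Set.Iio 0) = 0 := by
      rw [hμdef, Measure.map_apply (measurable_const_mul _) measurableSet_Iio]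
      refine measure_mono_null (fun y hy => ?_) (windowKernel_Iio_zero α hβ (lossTimeKernel α p) v)
      exact (pos_iff_neg_of_mul_neg hy).1 hη4
    have hκ0 : κ x (Set.Iio 0) = 0 := windowKernel_Iio_zero α hβ _ x
    have hanti := antitoneOn_boundedIter_limit hα hβ n fun i => a (i + 1)
    have hone : ∀ y, G y ≤ 1 := boundedIter_le_one _ n _ fun _ => le_rfl
    have hstep1 : ∫⁻ z, (Set.Iic (a 0)).indicator G z ∂μ ≤
        ∫⁻ z, (Set.Iic (a 0)).indicator G z ∂κ x + δ₂ :=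
      lintegral_indicator_Iic_le_add hμ0 hκ0
        (fun b hb => (hK₂ p η v x b hη hpη hv hx hxv hb).1) hanti hone
    have hstep2 : ∫⁻ z, (Set.Iic (a 0)).indicator G z ∂κ x ≤
        ∫⁻ z, (Set.Iic (a 0)).indicator G z ∂μ + δ₂ :=
      lintegral_indicator_Iic_le_add hκ0 hμ0
        (fun b hb => (hK₂ p η v x b hη hpη hv hx hxv hb).2) hanti hone
    have hconst : ∀ f : ℝ → ℝ≥0∞, ∫⁻ y, (f y + δ₁) ∂κp v = ∫⁻ y, f y ∂κp v + δ₁ := fun f => by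
      rw [lintegral_add_right _ measurable_const]; simp
    have hstep3 : ∫⁻ y, (Set.Iic (a 0 / η ^ 4)).indicator Gp y ∂κp v ≤
        ∫⁻ z, (Set.Iic (a 0)).indicator G z ∂μ + δ₁ := by
      rw [hmap, ← hconst]
      refine lintegral_mono_ae ?_
      filter_upwards [hclose] with y hy
      simp only [Set.indicator_apply, hmem]
      split_ifs
      · exact hy.1
      · exact zero_le
    have hstep4 : ∫⁻ z, (Set.Iic (a 0)).indicator G z ∂μ ≤
        ∫⁻ y, (Set.Iic (a 0 / η ^ 4)).indicator Gp y ∂κp v + δ₁ := by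
      rw [hmap, ← hconst]
      refine lintegral_mono_ae ?_
      filter_upwards [hclose] with y hy
      simp only [Set.indicator_apply, hmem]
      split_ifs
      · exact hy.2
      · exact zero_le
    rw [hδ]
    constructor
    · calc _ ≤ _ := hstep3
        _ ≤ _ := add_le_add_left hstep1 δ₁
        _ = _ := by rw [add_assoc, add_comm δ₂]; rfl
    · calc _ ≤ _ := hstep2
        _ ≤ _ := add_le_add_left hstep4 δ₂
        _ = _ := by rw [add_assoc]; rfl

theorem abs_toReal_sub_le {s t : ℝ≥0∞} {δ : ℝ} (hs : s ≠ ∞) (ht : t ≠ ∞) (hδ : 0 ≤ δ)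
    (h1 : s ≤ t + ENNReal.ofReal δ) (h2 : t ≤ s + ENNReal.ofReal δ) :
    |s.toReal - t.toReal| ≤ δ := by
  have e : ∀ {a b : ℝ≥0∞}, b ≠ ∞ → a ≤ b + ENNReal.ofReal δ → a.toReal ≤ b.toReal + δ := by
    intro a b hb hab
    have := ENNReal.toReal_mono (ENNReal.add_ne_top.2 ⟨hb, ENNReal.ofReal_ne_top⟩) hab
    rwa [ENNReal.toReal_add hb ENNReal.ofReal_ne_top, ENNReal.toReal_ofReal hδ] at this
  have := e ht h1
  have := e hs h2
  rw [abs_le]; constructor <;> linarith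

end TCPCompound

theorem mainTheorem5 (α β : ℝ) (hα : 0 < α) (hβ₀ : 0 < β) (hβ₁ : β < 1)
    (n : ℕ) (a : Fin n → ℝ) (ha : ∀ i, 0 ≤ a i) :
    Tendsto
      (fun p : unitInterval => ⨆ x : Set.Ici ((p : ℝ) ^ (1 / (2 - TCPCompound.k))),
        |(TCPCompound.lossChainLaw α β p
              (⌊(x : ℝ) / (p : ℝ) ^ (1 / (2 - TCPCompound.k))⌋₊ : ℝ)).real
            {V | ∀ i : Fin n, (p : ℝ) ^ (1 / (2 - TCPCompound.k)) * V (i + 1) ≤ a i}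
          - (TCPCompound.limitChainLaw hα β x).real {V | ∀ i : Fin n, V (i + 1) ≤ a i}|)
      (𝓝[>] 0) (𝓝 0) := by
  set a' : ℕ → ℝ := fun i => if h : i < n then a ⟨i, h⟩ else 0 with ha'
  obtain ⟨K, hK0, hK⟩ := TCPCompound.exists_boundedIter_le hα hβ₁ n a'
  have hlim : Tendsto (fun p : unitInterval => K * (p : ℝ) ^ (1 / 5 : ℝ)) (𝓝[>] 0) (𝓝 0) := by
    have hc : Continuous fun p : unitInterval => K * (p : ℝ) ^ (1 / 5 : ℝ) :=
      continuous_const.mul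
        (continuous_subtype_val.rpow_const fun _ => Or.inr (by norm_num))
    have := hc.tendsto 0
    simp only [Set.Icc.coe_zero] at this
    rw [Real.zero_rpow (by norm_num), mul_zero] at this
    exact this.mono_left nhdsWithin_le_nhds
  refine squeeze_zero' (Eventually.of_forall fun p => Real.iSup_nonneg fun x => abs_nonneg _) ?_
    hlim
  filter_upwards [self_mem_nhdsWithin] with p hp
  have hp0 : 0 < (p : ℝ) := hp
  set η := (p : ℝ) ^ (1 / 5 : ℝ) with hη
  have hη0 : 0 < η := by positivity
  have hpη : (p : ℝ) = η ^ 5 := by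
    rw [hη, ← Real.rpow_natCast, ← Real.rpow_mul hp0.le]; norm_num
  have hε : (p : ℝ) ^ (1 / (2 - TCPCompound.k)) = η ^ 4 := by
    rw [hη, ← Real.rpow_natCast, ← Real.rpow_mul hp0.le]
    congr 1
    norm_num [TCPCompound.k]
  have hη4 : 0 < η ^ 4 := by positivity
  rw [hε]
  have hset : {V : ℕ → ℝ | ∀ i : Fin n, V (i + 1) ≤ a i} = {V | ∀ i < n, V (i + 1) ≤ a' i} := by
    ext V
    refine ⟨fun h i hi => ?_, fun h i => ?_⟩
    · simpa [ha', hi] using h ⟨i, hi⟩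
    · simpa [ha'] using h i i.2
  have hset' : {V : ℕ → ℝ | ∀ i : Fin n, η ^ 4 * V (i + 1) ≤ a i} =
      {V | ∀ i < n, V (i + 1) ≤ a' i / η ^ 4} := by
    ext V
    refine ⟨fun h i hi => ?_, fun h i => ?_⟩
    · simpa [ha', hi, le_div_iff₀ hη4, mul_comm] using h ⟨i, hi⟩
    · simpa [ha', le_div_iff₀ hη4, mul_comm] using h i i.2
  refine Real.iSup_le (fun x => ?_) (by positivity)
  have hx : η ^ 4 ≤ (x : ℝ) := x.2
  have hx0 : 0 ≤ (x : ℝ) := hη4.le.trans hx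
  -- Rounding the initial window moves it by at most one packet, that is `η ^ 4` after scaling.
  have hclose : |(x : ℝ) - η ^ 4 * (⌊(x : ℝ) / η ^ 4⌋₊ : ℝ)| ≤ η ^ 4 := by
    have h1 := Nat.floor_le (show 0 ≤ (x : ℝ) / η ^ 4 by positivity)
    have h2 := (Nat.lt_floor_add_one ((x : ℝ) / η ^ 4)).le
    rw [le_div_iff₀ hη4] at h1
    rw [div_le_iff₀ hη4] at h2
    rw [abs_le]
    constructor <;> linarith
  obtain ⟨h1, h2⟩ := hK p η _ x hη0 hpη (Nat.cast_nonneg _) hx0 hclose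
  rw [← TCPCompound.chainLaw_forall_lt_le, ← TCPCompound.chainLaw_forall_lt_le] at h1 h2
  rw [hset, hset']
  exact TCPCompound.abs_toReal_sub_le (measure_ne_top (TCPCompound.chainLaw _ _) _)
    (measure_ne_top (TCPCompound.chainLaw _ _) _) (by positivity) h1 h2
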